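/- Consider second order ODEs $y''=Q(x,y,y')$ with $Q$ a smooth real function of $(x,y,p)$ on an open subset $U$ of $\mathbb R^3$ (an open set of the first jet space). Put $D=\partial_x+p\,\partial_y+Q\,\partial_p$ and let $$w_1=D^2Q_{pp}-4DQ_{py}-(DQ_{pp})\,Q_p+4Q_pQ_{py}-3Q_{pp}Q_y+6Q_{yy},\qquad w_2=Q_{pppp}$$ be the Lie relative invariants; let $\omega^1=dy-p\,dx$, $\omega^2=dp-Q\,dx$, $\omega^3=dx$. Two such ODEs are point equivalent near the points $z$ and $z'$ of their domains if there is a diffeomorphism $\phi$ from a neighbourhood of $z$ onto a neighbourhood of $z'$ with $\phi(z)=z'$ and $\phi^*\omega'^1=a\,\omega^1$, $\phi^*\omega'^2=b\,\omega^2+c\,\omega^1$, $\phi^*\omega'^3=b'\omega^3+c'\omega^1$ for real functions $a,b,b',c,c'$ with $a,b,b'$ nowhere zero. They are (locally) point equivalent if every point of either domain is matched in this way with some point of the other. An ODE $Y''=q(X,Y,Y')$ near $z'$ is dual to $y''=Q(x,y,y')$ near $z$ if some 3-dimensional hypersurface $N\subset\mathbb R^2\times\mathbb R^2$ in the variables $(x,y,X,Y)$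 is the graph of a smooth function $y=y(x,X,Y)$ on an open set, and also the graph of a smooth function $Y=Y(X,x,y)$ on an open set, such that the first function is locally the general solution of $y''=Q$ with constants of integration $X,Y$ (for fixed $(X,Y)$ it solves the equation, and $(x,X,Y)\mapsto(x,y,y_x)$ has nonvanishing Jacobian), the second is in the same sense locally the general solution of $Y''=q$ with constants of integration $x,y$, and $z=(x,y,y_x)$, $z'=(X,Y,Y_X)$ for some point $(x,y,X,Y)$ of $N$. The second ODE is dual to the first if every point of either domain is matched in this way with some point of the other. The dual class of a point equivalence class $\mathcal C$ consists of all ODEs that are point equivalent to a dual of a member of $\mathcal C$. **Proposition.** (a) If an ODE has $w_2=0$ and $w_1\neq0$ on its domain, then every ODE in the dual class of its point equivalence class has $w_1=0$ and $w_2\neq0$ on its domain. This holds both when "$\neq0$" means "nowhere zero" and when it means "not identically zero". (b) Duality interchanges the two relative invariants. Suppose that an ODE near $a_0$ is point equivalent to an ODE near $a$, that this one has a given ODE near $b$ as a dual, and that the latter is point equivalent to an ODE near $b_0$. Then $w_1$ of the last equation vanishes at $b_0$ if and only if $w_2$ of the first vanishes at $a_0$, and $w_2$ of the last vanishes at $b_0$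 if and only if $w_1$ of the first vanishes at $a_0$. -/

import Mathlib

open Set Filter Topology
open scoped ContDiff

/-- The coordinate space `ℝ³`; as the first jet space its points are `(x, y, p)`. -/
abbrev R3 : Type := ℝ × ℝ × ℝ

/-- Partial derivative with respect to the first coordinate. -/
noncomputable def pd1 (f : R3 → ℝ) (z : R3) : ℝ := fderiv ℝ f z (1, 0, 0)

/-- Partial derivative with respect to the second coordinate. -/
noncomputable def pd2 (f : R3 → ℝ) (z : R3) : ℝ := fderiv ℝ f z (0, 1, 0)

/-- Partial derivative with respect to the third coordinate. -/
noncomputable def pd3 (f : R3 → ℝ) (z : R3) : ℝ := fderiv ℝ f z (0, 0, 1)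

/-- A second order ODE `y'' = Q(x, y, y')` whose right-hand side is smooth on an open set `dom`
of the first jet space. Values of `Q` outside `dom` play no role. -/
structure SecondOrderODE where
  /-- the domain of the right-hand side -/
  dom : Set R3
  isOpen_dom : IsOpen dom
  /-- the right-hand side -/
  Q : R3 → ℝ
  contDiffOn_Q : ContDiffOn ℝ ∞ Q dom

namespace SecondOrderODE

/-- The total differential `D = ∂_x + p ∂_y + Q ∂_p`. -/
noncomputable def D (E : SecondOrderODE) (f : R3 → ℝ) (z : R3) : ℝ :=
  pd1 f z + z.2.2 * pd2 f z + E.Q z * pd3 f z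

/-- The Lie relative invariant
`w₁ = D²Q_pp - 4 DQ_py - (DQ_pp) Q_p + 4 Q_p Q_py - 3 Q_pp Q_y + 6 Q_yy`. -/
noncomputable def w1 (E : SecondOrderODE) (z : R3) : ℝ :=
  E.D (E.D (pd3 (pd3 E.Q))) z - 4 * E.D (pd2 (pd3 E.Q)) z
    - E.D (pd3 (pd3 E.Q)) z * pd3 E.Q z + 4 * pd3 E.Q z * pd2 (pd3 E.Q) z
    - 3 * pd3 (pd3 E.Q) z * pd2 E.Q z + 6 * pd2 (pd2 E.Q) z

/-- The Lie relative invariant `w₂ = Q_pppp`. -/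
noncomputable def w2 (E : SecondOrderODE) (z : R3) : ℝ :=
  pd3 (pd3 (pd3 (pd3 E.Q))) z

/-- The coordinate one-form `dx`, on the first jet space. -/
noncomputable def dx : R3 →L[ℝ] ℝ := ContinuousLinearMap.fst ℝ ℝ (ℝ × ℝ)

/-- The coordinate one-form `dy`, on the first jet space. -/
noncomputable def dy : R3 →L[ℝ] ℝ :=
  (ContinuousLinearMap.fst ℝ ℝ ℝ).comp (ContinuousLinearMap.snd ℝ ℝ (ℝ × ℝ))

/-- The coordinate one-form `dp`, on the first jet space. -/
noncomputable def dp : R3 →L[ℝ] ℝ :=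
  (ContinuousLinearMap.snd ℝ ℝ ℝ).comp (ContinuousLinearMap.snd ℝ ℝ (ℝ × ℝ))

/-- `ω¹ = dy - p dx`. -/
noncomputable def omega1 (_E : SecondOrderODE) (z : R3) : R3 →L[ℝ] ℝ := dy - z.2.2 • dx

/-- `ω² = dp - Q dx`. -/
noncomputable def omega2 (E : SecondOrderODE) (z : R3) : R3 →L[ℝ] ℝ := dp - E.Q z • dx

/-- `ω³ = dx`. -/
noncomputable def omega3 (_E : SecondOrderODE) (_z : R3) : R3 →L[ℝ] ℝ := dx

/-- `E` near the point `z` is point equivalent to `E'` near the point `z'`: some diffeomorphism `φ`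
from a neighbourhood of `z` in `E.dom` onto a neighbourhood of `z'` in `E'.dom` satisfies
`φ^*ω'¹ = a ω¹`, `φ^*ω'² = b ω² + c ω¹`, `φ^*ω'³ = b' ω³ + c' ω¹` with `a, b, b'` nowhere zero. -/
def PointEquivalentAt (E : SecondOrderODE) (z : R3) (E' : SecondOrderODE) (z' : R3) : Prop :=
  ∃ φ : OpenPartialHomeomorph R3 R3,
    z ∈ φ.source ∧ φ z = z' ∧ φ.source ⊆ E.dom ∧ φ.target ⊆ E'.dom ∧
    ContDiffOn ℝ ∞ φ φ.source ∧ ContDiffOn ℝ ∞ φ.symm φ.target ∧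
    ∀ s ∈ φ.source, ∃ a b b' c c' : ℝ, a ≠ 0 ∧ b ≠ 0 ∧ b' ≠ 0 ∧
      (E'.omega1 (φ s)).comp (fderiv ℝ φ s) = a • E.omega1 s ∧
      (E'.omega2 (φ s)).comp (fderiv ℝ φ s) = b • E.omega2 s + c • E.omega1 s ∧
      (E'.omega3 (φ s)).comp (fderiv ℝ φ s) = b' • E.omega3 s + c' • E.omega1 s

/-- Local point equivalence of two ODEs: around every point of either domain there is a local
point equivalence with the other equation. -/
def PointEquivalent (E E' : SecondOrderODE) : Prop :=
  (∀ z ∈ E.dom, ∃ z' ∈ E'.dom, E.PointEquivalentAt z E' z') ∧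
    (∀ z' ∈ E'.dom, ∃ z ∈ E.dom, E.PointEquivalentAt z E' z')

/-- `u`, defined for `(x, X, Y)` in the open set `W`, is (locally) the general solution
`y = u(x, X, Y)` of `E`, with constants of integration `X, Y`: every `x ↦ u(x, X, Y)` is a solution,
and `(x, X, Y) ↦ (x, u, u_x)` has nowhere vanishing Jacobian `u_X u_xY - u_Y u_xX`. -/
def IsGeneralSolution (E : SecondOrderODE) (u : R3 → ℝ) (W : Set R3) : Prop :=
  IsOpen W ∧ ContDiffOn ℝ ∞ u W ∧
    ∀ t ∈ W, (t.1, u t, pd1 u t) ∈ E.dom ∧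
      pd1 (pd1 u) t = E.Q (t.1, u t, pd1 u t) ∧
      pd2 u t * pd3 (pd1 u) t - pd3 u t * pd2 (pd1 u) t ≠ 0

/-- The hypersurface `{(x, y, X, Y) | y = u(x, X, Y)}` in `ℝ² × ℝ²` generated by a general solution
`u` on `W`. -/
def solutionHypersurface (u : R3 → ℝ) (W : Set R3) : Set ((ℝ × ℝ) × (ℝ × ℝ)) :=
  {n | (n.1.1, n.2.1, n.2.2) ∈ W ∧ n.1.2 = u (n.1.1, n.2.1, n.2.2)}

/-- `F` near the point `z'` is dual to `E` near the point `z`: there is a hypersurface in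
`ℝ² × ℝ²` which, read as `y = u(x, X, Y)`, is a general solution of `E` and which, with the roles of
the pairs `(x, y)` and `(X, Y)` swapped, i.e. read as `Y = v(X, x, y)`, is a general solution
of `F`; and some point `(x, y, X, Y)` of this hypersurface has the first jets
`z = (x, y, u_x)` and `z' = (X, Y, v_X)`. -/
def DualAt (E : SecondOrderODE) (z : R3) (F : SecondOrderODE) (z' : R3) : Prop :=
  ∃ (u : R3 → ℝ) (W : Set R3) (v : R3 → ℝ) (W' : Set R3),
    E.IsGeneralSolution u W ∧ F.IsGeneralSolution v W' ∧
    (∀ n : (ℝ × ℝ) × (ℝ × ℝ),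
      n ∈ solutionHypersurface u W ↔ n.swap ∈ solutionHypersurface v W') ∧
    ∃ x y X Y : ℝ, ((x, y), (X, Y)) ∈ solutionHypersurface u W ∧
      z = (x, y, pd1 u (x, X, Y)) ∧ z' = (X, Y, pd1 v (X, x, y))

/-- `F` is dual to `E`: around every point of either domain the two equations are dual. -/
def IsDual (E F : SecondOrderODE) : Prop :=
  (∀ z ∈ E.dom, ∃ z' ∈ F.dom, E.DualAt z F z') ∧ (∀ z' ∈ F.dom, ∃ z ∈ E.dom, E.DualAt z F z')

/-- The point equivalence class of an ODE. -/
def pointClass (E : SecondOrderODE) : Set SecondOrderODE := {E' | E.PointEquivalent E'}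

/-- The class of the dual equations to the equations of a point equivalence class `C`: all
equations that are point equivalent to a dual of a member of `C`. -/
def dualClass (C : Set SecondOrderODE) : Set SecondOrderODE :=
  {F | ∃ E ∈ C, ∃ F' : SecondOrderODE, E.IsDual F' ∧ F'.PointEquivalent F}

end SecondOrderODE

/-! An ODE equips the jet space with two direction fields: the solutions, spanned by `D`, and the
fibres, spanned by `∂_p`. Point equivalences preserve both fields and duality swaps them, so
everything reduces to one claim (`w1_eq_of_exchange`): if `χ` takes solutions of `E` to fibres and
fibres to solutions of `F`, then `w₁` of `E` is a nowhere zero multiple of `w₂` of `F` pulled back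
by `χ`.

Let `X, V, P` be the components of `χ`. Along a solution of `E` the functions `X` and `V` are
constant, and `∂_p X` and `∂_p V = P ∂_p X` solve the same second order linear equation, with
coefficients built from `Q_p` and `Q_y`. Hence `P` is a ratio of two solutions, and twice its
Schwarzian is `κ = 2 D Q_p - 4 Q_y - Q_p²`. Now `2 w₁` is a second order expression in `κ`
(`two_mul_lie_w1`). On the other hand, moving along `∂_p` changes `P` by a multiple of the
right-hand side `q₀` of `F`. The Schwarzian then varies through the third `P`-derivative of `q₀`,
and one more derivative along the solution gives the fourth, which is `w₂` of `F`
(`schwarzian_variation`). -/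

/-! ### Differential algebra of the Schwarzian and of `w₁` -/

section DifferentialAlgebra

variable {R : Type*} [CommRing R]

/-- The variation of the Schwarzian derivative `κ = 2 A l - l²`, `l = A λ / λ`, `λ = A P`, along a
derivation `D` with `⁅A, D⁆ = λ Z`, where `Z` commutes with `A`. -/
theorem schwarzian_variation (A D Z : Derivation ℤ R R) {P lam l q₀ q₁ q₂ q₃ q₄ : R}
    (hunit : IsUnit lam)
    (hAD : ∀ f, A (D f) - D (A f) = lam * Z f) (hZA : ∀ f, Z (A f) = A (Z f))
    (hP : A P = lam) (hl : A lam = l * lam) (hD : D P = q₀)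
    (h₀ : A q₀ = lam * q₁) (h₁ : A q₁ = lam * q₂) (h₂ : A q₂ = lam * q₃) (h₃ : A q₃ = lam * q₄) :
    2 * lam ^ 3 * q₄ = 4 * A (D (2 * A l - l * l)) - 3 * D (A (2 * A l - l * l))
      - 2 * l * D (2 * A l - l * l) := by
  have two (T : Derivation ℤ R R) : T (2 : R) = 0 := by
    simpa using T.map_natCast 2
  obtain ⟨h, hh⟩ : ∃ h, Z P = h := ⟨_, rfl⟩
  obtain ⟨g, hg⟩ : ∃ g, Z l = g := ⟨_, rfl⟩
  have e1 : Z lam = A h := by rw [← hP, hZA, hh]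
  have e2 : D lam = lam * q₁ - lam * h := by
    have := hAD P
    rw [hP, hD, hh, h₀] at this
    linear_combination -this
  have e3 : lam * g = A (A h) - l * A h := by
    have := hZA lam
    rw [hl, e1, Z.leibniz, hg, e1] at this
    simp only [smul_eq_mul] at this
    linear_combination this
  have e4 : D l = lam * q₂ - 2 * A h := by
    have := hAD lam
    rw [hl, e1, e2] at this
    simp only [map_sub, Derivation.leibniz, smul_eq_mul, hl, h₁, e2] at this
    apply hunit.mul_left_cancel
    linear_combination -this
  have e5 : D (A l) = l * lam * q₂ + lam ^ 2 * q₃ - 2 * A (A h) - lam * g := by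
    have := hAD l
    rw [e4, hg] at this
    simp only [map_sub, Derivation.leibniz, smul_eq_mul, hl, h₂, two] at this
    linear_combination -this
  obtain ⟨k, hk⟩ : ∃ k, 2 * A l - l * l = k := ⟨_, rfl⟩
  -- For `Z = 0` this is the classical variation of the Schwarzian under `q₀ ∂_P`; the term in `g`
  -- is the correction for `⁅A, D⁆ ≠ 0`.
  have e6 : D k = 2 * lam ^ 2 * q₃ - 6 * lam * g := by
    rw [← hk]
    simp only [map_sub, Derivation.leibniz, smul_eq_mul, two, e4, e5]
    linear_combination 4 * e3
  have e7 : Z k = 2 * A g - 2 * l * g := by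
    rw [← hk]
    simp only [map_sub, Derivation.leibniz, smul_eq_mul, two, hZA, hg]
    ring
  have six : A (6 : R) = 0 := by simpa using A.map_natCast 6
  have e8 := hAD k
  have e9 : A (D k) = 4 * l * lam ^ 2 * q₃ + 2 * lam ^ 3 * q₄ - 6 * l * lam * g
      - 6 * lam * A g := by
    rw [e6]
    simp only [map_sub, Derivation.leibniz, smul_eq_mul, two, six, hl, h₃, pow_two]
    ring
  rw [hk]
  rw [e7] at e8
  -- Three times the commutator on `k` removes `A g` from `A (D k)`; subtracting `2 * l * D k` then
  -- removes both `g` and `q₃`.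
  linear_combination -3 * e8 - e9 + 2 * l * e6

/-- The Lie relative invariant `w₁`, in terms of derivations `A = D`, `B = ∂_p`, `Y = ∂_y`, as
a second order expression in the Schwarzian `κ = 2 D Q_p - 4 Q_y - Q_p²`. -/
theorem two_mul_lie_w1 (A B Y : Derivation ℤ R R) {Q : R}
    (hBA : ∀ f, B (A f) - A (B f) = Y f + B Q * B f)
    (hYA : ∀ f, Y (A f) - A (Y f) = Y Q * B f)
    (hBY : ∀ f, B (Y f) = Y (B f)) {k : R} (hk : k = 2 * A (B Q) - 4 * Y Q - B Q * B Q) :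
    4 * A (B k) - 3 * B (A k) + 2 * B Q * B k =
      2 * (A (A (B (B Q))) - 4 * A (Y (B Q)) - A (B (B Q)) * B Q + 4 * B Q * Y (B Q)
        - 3 * B (B Q) * Y Q + 6 * Y (Y Q)) := by
  have two (T : Derivation ℤ R R) : T (2 : R) = 0 := by simpa using T.map_natCast 2
  have four (T : Derivation ℤ R R) : T (4 : R) = 0 := by simpa using T.map_natCast 4
  have e1 : B k = 2 * A (B (B Q)) - 2 * Y (B Q) := by
    have := hBA (B Q)
    rw [hk]
    simp only [map_sub, Derivation.leibniz, smul_eq_mul, two, four, hBY]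
    linear_combination 2 * this
  have e2 : Y k = 2 * A (Y (B Q)) + 2 * Y Q * B (B Q) - 4 * Y (Y Q) - 2 * B Q * Y (B Q) := by
    have := hYA (B Q)
    rw [hk]
    simp only [map_sub, Derivation.leibniz, smul_eq_mul, two, four]
    linear_combination 2 * this
  have e3 : A (B k) = 2 * A (A (B (B Q))) - 2 * A (Y (B Q)) := by
    rw [e1]
    simp only [map_sub, Derivation.leibniz, smul_eq_mul, two]
    ring
  have e4 := hBA k
  linear_combination -3 * e4 + e3 - 3 * e2 - B Q * e1

/-- The derivation form of the exchange of the relative invariants: if `X`, `V`, `P` satisfy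
`A X = A V = 0`, `B V = P B X`, `B P = q₀ B X`, then `w₁ = (B X) (A P)³ q₄`, where `q₄` is the fourth
derivative of `q₀` with respect to `P`. -/
theorem lie_w1_eq_of_exchange (A B Y : Derivation ℤ R R) {Q X V P lam mu q₀ q₁ q₂ q₃ q₄ : R}
    (htwo : IsUnit (2 : R))
    (hBA : ∀ f, B (A f) - A (B f) = Y f + B Q * B f)
    (hYA : ∀ f, Y (A f) - A (Y f) = Y Q * B f)
    (hBY : ∀ f, B (Y f) = Y (B f))
    (hlam : IsUnit lam) (hmu : IsUnit mu)
    (hX : A X = 0) (hV : A V = 0) (hP : A P = lam)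
    (hBX : B X = mu) (hBV : B V = mu * P) (hBP : B P = mu * q₀)
    (h₀ : A q₀ = lam * q₁) (h₁ : A q₁ = lam * q₂) (h₂ : A q₂ = lam * q₃) (h₃ : A q₃ = lam * q₄) :
    A (A (B (B Q))) - 4 * A (Y (B Q)) - A (B (B Q)) * B Q + 4 * B Q * Y (B Q)
        - 3 * B (B Q) * Y Q + 6 * Y (Y Q) = mu * lam ^ 3 * q₄ := by
  have two (T : Derivation ℤ R R) : T (2 : R) = 0 := by simpa using T.map_natCast 2
  obtain ⟨lami, hlami⟩ := hlam.exists_right_inv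
  obtain ⟨mui, hmui⟩ := hmu.exists_right_inv
  obtain ⟨s, hs⟩ : ∃ s, B Q = s := ⟨_, rfl⟩
  obtain ⟨q, hq⟩ : ∃ q, Y Q = q := ⟨_, rfl⟩
  -- `m` is the logarithmic derivative of `mu` along the solutions.
  obtain ⟨m, hm⟩ : ∃ m, A mu = m * mu :=
    ⟨A mu * mui, by linear_combination -(A mu) * hmui⟩
  rw [hs] at hBA
  rw [hq] at hYA
  -- For a first integral `W`, the function `B W` solves the adjoint of the linearised equation `η''
  -- = s η' + q η`: `Y W` is eliminated between the two commutators.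
  have second {W nu : R} (hW : A W = 0) (hnu : B W = nu) :
      A (A nu) + A s * nu + s * A nu = q * nu := by
    have e1 := hBA W
    have e2 := hYA W
    rw [hW, hnu, map_zero] at e1 e2
    have e3 : Y W = -A nu - s * nu := by linear_combination -e1
    rw [e3] at e2
    simp only [map_sub, map_neg, Derivation.leibniz, smul_eq_mul] at e2
    linear_combination e2
  have s1 := second hX hBX
  have s2 := second hV hBV
  -- Riccati form of the linear equation for `mu`.
  have hAm : A m + m * m + A s + s * m = q := by
    apply hmu.mul_left_cancel
    simp only [hm, Derivation.leibniz, smul_eq_mul] at s1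
    linear_combination s1
  -- Reduction of order: `mu` and `mu * P` solve the same equation, which leaves a first order
  -- equation for `lam = A P`.
  have hl : A lam = -(s + 2 * m) * lam := by
    apply hmu.mul_left_cancel
    simp only [hm, Derivation.leibniz, smul_eq_mul, hP, map_add] at s1 s2
    linear_combination s2 - P * s1
  have hAmui : A mui = -(m * mui) := by
    apply hmu.mul_left_cancel
    have := congrArg A hmui
    simp only [Derivation.leibniz, smul_eq_mul, hm, Derivation.map_one_eq_zero] at this
    linear_combination this
  have hAlami : A lami = (s + 2 * m) * lami := by
    apply hlam.mul_left_cancel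
    have := congrArg A hlami
    simp only [Derivation.leibniz, smul_eq_mul, hl, Derivation.map_one_eq_zero] at this
    linear_combination this
  obtain ⟨k, hk⟩ : ∃ k, 2 * A (-(s + 2 * m)) - (-(s + 2 * m)) * (-(s + 2 * m)) = k := ⟨_, rfl⟩
  -- `B` is rescaled so that it sends `X` to `1` and `P` to `q₀`. The third derivation is then
  -- forced by the commutator with `A`, and it commutes with `A` because of `hAm`.
  have key := schwarzian_variation A (mui • B) (-(lami * mui) • (Y + (s + m) • B))
    (P := P) (lam := lam) (l := -(s + 2 * m)) (q₀ := q₀) (q₁ := q₁) (q₂ := q₂) (q₃ := q₃)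
    (q₄ := q₄) hlam
    (by
      intro f
      simp only [Derivation.smul_apply, Derivation.add_apply, Derivation.leibniz, smul_eq_mul,
        hAmui]
      linear_combination -mui * hBA f + mui * (Y f + (s + m) * B f) * hlami)
    (by
      intro f
      simp only [Derivation.smul_apply, Derivation.add_apply, Derivation.leibniz, smul_eq_mul,
        hAmui, hAlami, map_add, map_neg]
      linear_combination -lami * mui * (hYA f + (s + m) * hBA f) + lami * mui * B f * hAm)
    hP hl
    (by simp only [Derivation.smul_apply, smul_eq_mul, hBP]
        linear_combination q₀ * hmui)
    h₀ h₁ h₂ h₃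
  -- The Riccati equation eliminates `m`, so the Schwarzian of `P` depends on `Q` alone.
  have hk' : k = 2 * A (B Q) - 4 * Y Q - B Q * B Q := by
    rw [hs, hq, ← hk]
    simp only [map_neg, map_add, Derivation.leibniz, smul_eq_mul, two]
    linear_combination -4 * hAm
  have hw := two_mul_lie_w1 A B Y (by rwa [hs]) (by rwa [hq]) hBY hk'
  rw [hk] at key
  simp only [Derivation.smul_apply, Derivation.leibniz, smul_eq_mul, hAmui] at key
  apply htwo.mul_left_cancel
  rw [hs] at hw
  rw [hs, ← hw]
  -- The terms in `m` from differentiating `mui` and from `l = -(s + 2 * m)` cancel.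
  linear_combination -mu * key + (4 * A (B k) - 3 * B (A k) + 2 * s * B k) * (-hmui)

end DifferentialAlgebra

/-! ### The ring of smooth germs and its derivations -/

section SmoothGerms

variable {V : Type*} [NormedAddCommGroup V] [NormedSpace ℝ V]

theorem ContDiffAt.eventually_differentiableAt {W : Type*} [NormedAddCommGroup W] [NormedSpace ℝ W]
    {f : V → W} {a : V} (hf : ContDiffAt ℝ ∞ f a) : ∀ᶠ z in 𝓝 a, DifferentiableAt ℝ f z := by
  have h1 : ContDiffAt ℝ 1 f a := hf.of_le (by simp)
  filter_upwards [h1.eventually (by simp)] with z hz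
  exact hz.differentiableAt (by simp)

theorem ContDiffAt.fderiv_apply_const {f : V → ℝ} {a : V} (hf : ContDiffAt ℝ ∞ f a) (v : V) :
    ContDiffAt ℝ ∞ (fun z => fderiv ℝ f z v) a :=
  (hf.fderiv_right (m := ∞) (by simp)).clm_apply contDiffAt_const

/-- The ring of germs at `a` of real functions that are smooth at `a`. -/
def smoothGerms (a : V) : Subring (Germ (𝓝 a) ℝ) where
  carrier := {g | ∃ f : V → ℝ, ContDiffAt ℝ ∞ f a ∧ (f : Germ (𝓝 a) ℝ) = g}
  mul_mem' := by
    rintro _ _ ⟨f, hf, rfl⟩ ⟨g, hg, rfl⟩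
    exact ⟨f * g, hf.mul hg, rfl⟩
  one_mem' := ⟨1, contDiffAt_const, rfl⟩
  add_mem' := by
    rintro _ _ ⟨f, hf, rfl⟩ ⟨g, hg, rfl⟩
    exact ⟨f + g, hf.add hg, rfl⟩
  zero_mem' := ⟨0, contDiffAt_const, rfl⟩
  neg_mem' := by
    rintro _ ⟨f, hf, rfl⟩
    exact ⟨-f, hf.neg, rfl⟩

namespace smoothGerms

variable {a : V}

/-- The germ of a function that is smooth at `a`. -/
def germ (f : V → ℝ) (hf : ContDiffAt ℝ ∞ f a) : smoothGerms a := ⟨f, f, hf, rfl⟩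

theorem exists_germ (g : smoothGerms a) : ∃ f, ∃ hf : ContDiffAt ℝ ∞ f a, germ f hf = g := by
  obtain ⟨_, f, hf, rfl⟩ := g
  exact ⟨f, hf, rfl⟩

theorem germ_eq_germ {f g : V → ℝ} {hf : ContDiffAt ℝ ∞ f a} {hg : ContDiffAt ℝ ∞ g a} :
    germ f hf = germ g hg ↔ f =ᶠ[𝓝 a] g := by
  rw [Subtype.ext_iff]
  exact Germ.coe_eq

theorem germ_mul {f g : V → ℝ} (hf : ContDiffAt ℝ ∞ f a) (hg : ContDiffAt ℝ ∞ g a) :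
    germ f hf * germ g hg = germ (fun z => f z * g z) (hf.mul hg) := rfl

theorem germ_add {f g : V → ℝ} (hf : ContDiffAt ℝ ∞ f a) (hg : ContDiffAt ℝ ∞ g a) :
    germ f hf + germ g hg = germ (fun z => f z + g z) (hf.add hg) := rfl

/-- Evaluation of germs at the base point. -/
def eval (a : V) : smoothGerms a →+* ℝ := Germ.valueRingHom.comp (smoothGerms a).subtype

theorem eval_germ (f : V → ℝ) (hf : ContDiffAt ℝ ∞ f a) : eval a (germ f hf) = f a := rfl

/-- Supplies the units by which the algebraic identities divide; this is why germs at a point are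
used. -/
theorem isUnit_germ {f : V → ℝ} (hf : ContDiffAt ℝ ∞ f a) (h : f a ≠ 0) : IsUnit (germ f hf) := by
  refine IsUnit.of_mul_eq_one (germ (fun z => (f z)⁻¹) (hf.inv h)) ?_
  rw [germ_mul]
  refine (germ_eq_germ (hg := contDiffAt_const)).2 ?_
  filter_upwards [hf.continuousAt.eventually_ne h] with z hz
  exact mul_inv_cancel₀ hz

/-- A chosen representative of a smooth germ. -/
noncomputable def rep (g : smoothGerms a) : V → ℝ := (exists_germ g).choose

theorem contDiffAt_rep (g : smoothGerms a) : ContDiffAt ℝ ∞ (rep g) a :=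
  (exists_germ g).choose_spec.choose

theorem germ_rep (g : smoothGerms a) : germ (rep g) (contDiffAt_rep g) = g :=
  (exists_germ g).choose_spec.choose_spec

theorem germ_fderiv_congr {f g : V → ℝ} {hf : ContDiffAt ℝ ∞ f a} {hg : ContDiffAt ℝ ∞ g a}
    (h : germ f hf = germ g hg) (v : V) :
    germ _ (hf.fderiv_apply_const v) = germ _ (hg.fderiv_apply_const v) := by
  rw [germ_eq_germ] at h ⊢
  filter_upwards [h.fderiv (𝕜 := ℝ)] with z hz
  rw [hz]

/-- The directional derivative of smooth germs. -/
noncomputable def dirDeriv (v : V) : Derivation ℤ (smoothGerms a) (smoothGerms a) :=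
  Derivation.mk'
    (AddMonoidHom.toIntLinearMap <| AddMonoidHom.mk'
      (fun g => germ _ ((contDiffAt_rep g).fderiv_apply_const v)) (by
        intro g h
        rw [germ_add]
        refine (germ_fderiv_congr (hf := contDiffAt_rep (g + h)) (g := fun z => rep g z + rep h z)
          (hg := (contDiffAt_rep g).add (contDiffAt_rep h)) ?_ v).trans ?_
        · rw [germ_rep, ← germ_add (contDiffAt_rep g) (contDiffAt_rep h), germ_rep, germ_rep]
        · rw [germ_eq_germ]
          filter_upwards [(contDiffAt_rep g).eventually_differentiableAt,
            (contDiffAt_rep h).eventually_differentiableAt] with z hg hh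
          rw [fderiv_fun_add hg hh]
          rfl))
    (by
      intro g h
      change germ _ ((contDiffAt_rep (g * h)).fderiv_apply_const v) =
        g * germ _ ((contDiffAt_rep h).fderiv_apply_const v)
          + h * germ _ ((contDiffAt_rep g).fderiv_apply_const v)
      refine (germ_fderiv_congr (hf := contDiffAt_rep (g * h)) (g := fun z => rep g z * rep h z)
          (hg := (contDiffAt_rep g).mul (contDiffAt_rep h)) ?_ v).trans ?_
      · rw [germ_rep, ← germ_mul (contDiffAt_rep g) (contDiffAt_rep h), germ_rep, germ_rep]
      · have hrep (p q : smoothGerms a) : g * p + h * q =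
            germ _ (contDiffAt_rep g) * p + germ _ (contDiffAt_rep h) * q := by simp only [germ_rep]
        rw [hrep, germ_mul, germ_mul, germ_add, germ_eq_germ]
        filter_upwards [(contDiffAt_rep g).eventually_differentiableAt,
            (contDiffAt_rep h).eventually_differentiableAt] with z hg hh
        rw [fderiv_fun_mul hg hh]
        simp)

theorem dirDeriv_germ (v : V) {f : V → ℝ} (hf : ContDiffAt ℝ ∞ f a) :
    dirDeriv v (germ f hf) = germ (fun z => fderiv ℝ f z v) (hf.fderiv_apply_const v) :=
  germ_fderiv_congr (germ_rep _) v

theorem dirDeriv_comm (v w : V) (g : smoothGerms a) : dirDeriv v (dirDeriv w g) = dirDeriv w (dirDeriv v g) := by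
  obtain ⟨f, hf, rfl⟩ := exists_germ g
  simp only [dirDeriv_germ]
  rw [germ_eq_germ]
  have h2 : ContDiffAt ℝ 2 f a := contDiffAt_infty.1 hf 2
  filter_upwards [h2.eventually (by simp),
    (hf.fderiv_right (m := ∞) (by simp)).eventually_differentiableAt] with z hz hd
  have hs : IsSymmSndFDerivAt ℝ f z := hz.isSymmSndFDerivAt (by simp)
  rw [fderiv_clm_apply hd (differentiableAt_const _), fderiv_clm_apply hd (differentiableAt_const _)]
  simpa using hs.eq v w

end smoothGerms

end SmoothGerms

/-! ### The exchange identity on the jet space -/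

namespace SecondOrderODE

/-- The coordinate direction of `x`. -/
abbrev dirX : R3 := (1, 0, 0)

/-- The coordinate direction of `y`. -/
abbrev dirY : R3 := (0, 1, 0)

/-- The coordinate direction of `p`. -/
abbrev dirP : R3 := (0, 0, 1)

/-- The direction `∂_x + p ∂_y + Q ∂_p` of the solutions. -/
def solutionDir (E : SecondOrderODE) (z : R3) : R3 := (1, z.2.2, E.Q z)

/-- The direction `∂_p` of the fibres of the first jet space. -/
def fibreDir (_z : R3) : R3 := (0, 0, 1)

theorem D_eq_fderiv (E : SecondOrderODE) (f : R3 → ℝ) (z : R3) :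
    E.D f z = fderiv ℝ f z (E.solutionDir z) := by
  have : E.solutionDir z = (1, 0, 0) + z.2.2 • (0, 1, 0) + E.Q z • (0, 0, 1) := by
    simp [solutionDir]
  rw [this]
  simp only [D, pd1, pd2, pd3, map_add, map_smul, smul_eq_mul]

theorem contDiffAt_Q (E : SecondOrderODE) {z : R3} (hz : z ∈ E.dom) : ContDiffAt ℝ ∞ E.Q z :=
  E.contDiffOn_Q.contDiffAt (E.isOpen_dom.mem_nhds hz)

theorem contDiffAt_solutionDir {E : SecondOrderODE} {z : R3} (hE : ContDiffAt ℝ ∞ E.Q z) :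
    ContDiffAt ℝ ∞ E.solutionDir z :=
  contDiffAt_const.prodMk ((contDiff_snd.snd.contDiffAt).prodMk hE)

theorem contDiffAt_D {E : SecondOrderODE} {z : R3} (hE : ContDiffAt ℝ ∞ E.Q z) {f : R3 → ℝ}
    (hf : ContDiffAt ℝ ∞ f z) : ContDiffAt ℝ ∞ (E.D f) z := by
  rw [funext (E.D_eq_fderiv f)]
  exact (hf.fderiv_right (m := ∞) (by simp)).clm_apply (contDiffAt_solutionDir hE)

theorem contDiffAt_pd3 {f : R3 → ℝ} {z : R3} (hf : ContDiffAt ℝ ∞ f z) : ContDiffAt ℝ ∞ (pd3 f) z :=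
  hf.fderiv_apply_const dirP

section GermDerivations

open smoothGerms

variable {E : SecondOrderODE} {a : R3}

theorem contDiffAt_coord_p : ContDiffAt ℝ ∞ (fun z : R3 => z.2.2) a :=
  contDiff_snd.snd.contDiffAt

/-- The total differential as a derivation of smooth germs. -/
noncomputable def germD (hE : ContDiffAt ℝ ∞ E.Q a) :
    Derivation ℤ (smoothGerms a) (smoothGerms a) :=
  dirDeriv dirX + germ (a := a) _ contDiffAt_coord_p • dirDeriv dirY + germ _ hE • dirDeriv dirP

theorem germD_germ (hE : ContDiffAt ℝ ∞ E.Q a) {f : R3 → ℝ} (hf : ContDiffAt ℝ ∞ f a) :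
    germD hE (germ f hf) = germ (E.D f) (contDiffAt_D hE hf) := by
  simp only [germD, Derivation.add_apply, Derivation.smul_apply, smul_eq_mul, dirDeriv_germ, germ_mul,
    germ_add]
  rfl

theorem dirDeriv_coord_p (v : R3) :
    dirDeriv v (germ (a := a) _ contDiffAt_coord_p) = germ (fun _ => v.2.2) contDiffAt_const := by
  rw [dirDeriv_germ, germ_eq_germ]
  refine Eventually.of_forall fun z => ?_
  have : HasFDerivAt (fun z : R3 => z.2.2) ((ContinuousLinearMap.snd ℝ ℝ ℝ).comp
    (ContinuousLinearMap.snd ℝ ℝ (ℝ × ℝ))) z :=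
    ((ContinuousLinearMap.snd ℝ ℝ ℝ).comp (ContinuousLinearMap.snd ℝ ℝ (ℝ × ℝ))).hasFDerivAt
  simp [this.fderiv]

theorem dirDeriv_p_coord_p : dirDeriv dirP (germ (a := a) _ contDiffAt_coord_p) = 1 :=
  dirDeriv_coord_p _

theorem dirDeriv_y_coord_p : dirDeriv dirY (germ (a := a) _ contDiffAt_coord_p) = 0 :=
  dirDeriv_coord_p _

/-- Coordinate derivatives commute, so only the coefficients `p` and `Q` of `D` contribute. -/
theorem dirDeriv_p_germD (hE : ContDiffAt ℝ ∞ E.Q a) (f : smoothGerms a) :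
    dirDeriv dirP (germD hE f) - germD hE (dirDeriv dirP f) =
      dirDeriv dirY f + dirDeriv dirP (germ _ hE) * dirDeriv dirP f := by
  simp only [germD, Derivation.add_apply, Derivation.smul_apply, smul_eq_mul, map_add,
    Derivation.leibniz, dirDeriv_p_coord_p, dirDeriv_comm dirP dirX,
    dirDeriv_comm dirP dirY]
  ring

theorem dirDeriv_y_germD (hE : ContDiffAt ℝ ∞ E.Q a) (f : smoothGerms a) :
    dirDeriv dirY (germD hE f) - germD hE (dirDeriv dirY f) =
      dirDeriv dirY (germ _ hE) * dirDeriv dirP f := by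
  simp only [germD, Derivation.add_apply, Derivation.smul_apply, smul_eq_mul, map_add,
    Derivation.leibniz, dirDeriv_y_coord_p, dirDeriv_comm dirY dirX,
    dirDeriv_comm dirY dirP]
  ring

end GermDerivations

open smoothGerms in
/-- If a smooth map carries the solutions of `E` to fibres and the fibres to solutions of `F`, then
it pulls back `w₂` of `F` to a nonzero multiple of `w₁` of `E`. -/
theorem w1_eq_of_exchange {E F : SecondOrderODE} {χ : R3 → R3} {a : R3}
    (hE : ContDiffAt ℝ ∞ E.Q a) (hF : ContDiffAt ℝ ∞ F.Q (χ a)) (hχ : ContDiffAt ℝ ∞ χ a)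
    (h : ∀ᶠ z in 𝓝 a, ∃ l m : ℝ, l ≠ 0 ∧ m ≠ 0 ∧
      fderiv ℝ χ z (E.solutionDir z) = l • fibreDir (χ z) ∧
      fderiv ℝ χ z (fibreDir z) = m • F.solutionDir (χ z)) :
    ∃ c : ℝ, c ≠ 0 ∧ E.w1 a = c * F.w2 (χ a) := by
  have hdχ : ContDiffAt ℝ ∞ (fderiv ℝ χ) a := hχ.fderiv_right (by simp)
  have hχd := hχ.eventually_differentiableAt
  -- The pointwise multipliers in `h` are read off from the components equal to `1` in `fibreDir`
  -- and `solutionDir`, which makes them smooth functions.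
  obtain ⟨l, hl⟩ : ∃ l : R3 → ℝ, l = fun z => (fderiv ℝ χ z (E.solutionDir z)).2.2 := ⟨_, rfl⟩
  obtain ⟨m, hm⟩ : ∃ m : R3 → ℝ, m = fun z => (fderiv ℝ χ z (fibreDir z)).1 := ⟨_, rfl⟩
  have hls : ContDiffAt ℝ ∞ l a := by
    rw [hl]
    exact (hdχ.clm_apply (contDiffAt_solutionDir hE)).snd.snd
  have hms : ContDiffAt ℝ ∞ m a := by
    rw [hm]
    exact (hdχ.clm_apply (contDiffAt_const (c := dirP))).fst
  have h' : ∀ᶠ z in 𝓝 a, l z ≠ 0 ∧ m z ≠ 0 ∧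
      fderiv ℝ χ z (E.solutionDir z) = l z • fibreDir (χ z) ∧
      fderiv ℝ χ z (fibreDir z) = m z • F.solutionDir (χ z) := by
    filter_upwards [h] with z hz
    obtain ⟨l', m', hl', hm', h1, h2⟩ := hz
    have e1 : l z = l' := by simp [hl, h1, fibreDir]
    have e2 : m z = m' := by simp [hm, h2, solutionDir]
    rw [e1, e2]
    exact ⟨hl', hm', h1, h2⟩
  have hx : ContDiffAt ℝ ∞ (fun z => (χ z).1) a := hχ.fst
  have hy : ContDiffAt ℝ ∞ (fun z => (χ z).2.1) a := hχ.snd.fst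
  have hp : ContDiffAt ℝ ∞ (fun z => (χ z).2.2) a := hχ.snd.snd
  have dx (z) (hz : DifferentiableAt ℝ χ z) (v) :
      fderiv ℝ (fun z => (χ z).1) z v = (fderiv ℝ χ z v).1 := by
    rw [hz.hasFDerivAt.fst.fderiv]; rfl
  have dy (z) (hz : DifferentiableAt ℝ χ z) (v) :
      fderiv ℝ (fun z => (χ z).2.1) z v = (fderiv ℝ χ z v).2.1 := by
    rw [hz.hasFDerivAt.snd.fst.fderiv]; rfl
  have dp (z) (hz : DifferentiableAt ℝ χ z) (v) :
      fderiv ℝ (fun z => (χ z).2.2) z v = (fderiv ℝ χ z v).2.2 := by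
    rw [hz.hasFDerivAt.snd.snd.fderiv]; rfl
  -- On functions pulled back by `χ`, the total differential acts as `l ∂_P`; so the `q₁, …, q₄` are
  -- the pullbacks of the successive `p`-derivatives of `F.Q`.
  have chain {f : R3 → ℝ} (hf : ContDiffAt ℝ ∞ f (χ a)) :
      germD hE (germ (f ∘ χ) (hf.comp a hχ)) =
        germ l hls * germ (pd3 f ∘ χ) ((contDiffAt_pd3 hf).comp a hχ) := by
    rw [germD_germ, germ_mul, germ_eq_germ]
    filter_upwards [h', hχd, hχ.continuousAt.eventually hf.eventually_differentiableAt]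
      with z hz hd hfz
    rw [D_eq_fderiv, fderiv_comp z hfz hd,
      ContinuousLinearMap.comp_apply, hz.2.2.1, map_smul]
    rfl
  have h0 := hF
  have h1 := contDiffAt_pd3 h0
  have h2 := contDiffAt_pd3 h1
  have h3 := contDiffAt_pd3 h2
  have ha := h'.self_of_nhds
  have htwo : IsUnit (2 : smoothGerms a) :=
    isUnit_germ (f := fun _ => 2) contDiffAt_const two_ne_zero
  have key := lie_w1_eq_of_exchange (germD hE) (dirDeriv dirP) (dirDeriv dirY)
    (Q := germ _ hE) (X := germ _ hx) (V := germ _ hy) (P := germ _ hp) (lam := germ l hls) (mu := germ m hms)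
    htwo (dirDeriv_p_germD hE) (dirDeriv_y_germD hE) (dirDeriv_comm _ _)
    (isUnit_germ hls ha.1) (isUnit_germ hms ha.2.1)
    (by
      rw [germD_germ]
      refine (germ_eq_germ (hg := contDiffAt_const)).2 ?_
      filter_upwards [h', hχd] with z hz hd
      rw [D_eq_fderiv, dx z hd, hz.2.2.1]
      simp [fibreDir])
    (by
      rw [germD_germ]
      refine (germ_eq_germ (hg := contDiffAt_const)).2 ?_
      filter_upwards [h', hχd] with z hz hd
      rw [D_eq_fderiv, dy z hd, hz.2.2.1]
      simp [fibreDir])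
    (by
      rw [germD_germ, germ_eq_germ]
      filter_upwards [h', hχd] with z hz hd
      rw [D_eq_fderiv, dp z hd, hz.2.2.1]
      simp [fibreDir])
    (by
      rw [dirDeriv_germ, germ_eq_germ]
      filter_upwards [h', hχd] with z hz hd
      rw [dx z hd]
      exact (congrArg Prod.fst hz.2.2.2).trans (by simp [solutionDir]))
    (by
      rw [dirDeriv_germ, germ_mul, germ_eq_germ]
      filter_upwards [h', hχd] with z hz hd
      rw [dy z hd]
      exact congrArg (fun v : R3 => v.2.1) hz.2.2.2)
    (q₀ := germ (F.Q ∘ χ) (hF.comp a hχ))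
    (by
      rw [dirDeriv_germ, germ_mul, germ_eq_germ]
      filter_upwards [h', hχd] with z hz hd
      rw [dp z hd]
      exact congrArg (fun v : R3 => v.2.2) hz.2.2.2)
    (chain h0) (chain h1) (chain h2) (chain h3)
  have := congrArg (eval a) key
  simp only [map_add, map_sub, map_mul, map_pow, map_ofNat, dirDeriv_germ, germD_germ, eval_germ] at this
  exact ⟨m a * l a ^ 3, mul_ne_zero ha.2.1 (pow_ne_zero _ ha.1), this⟩

/-! ### Maps that carry a pair of direction fields to another -/

/-- The map `χ` is smooth at `a`, sends `a` to `b`, and near `a` its derivative carries the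
directions `A`, `B` to the directions `A'`, `B'`. -/
def CarriesDirections (A B A' B' : R3 → R3) (χ : R3 → R3) (a b : R3) : Prop :=
  ContDiffAt ℝ ∞ χ a ∧ χ a = b ∧ ∀ᶠ z in 𝓝 a, ∃ l m : ℝ, l ≠ 0 ∧ m ≠ 0 ∧
    fderiv ℝ χ z (A z) = l • A' (χ z) ∧ fderiv ℝ χ z (B z) = m • B' (χ z)

namespace CarriesDirections

variable {A B A' B' A'' B'' : R3 → R3} {a b c : R3}

theorem comp {χ ψ : R3 → R3} (hψ : CarriesDirections A' B' A'' B'' ψ b c)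
    (hχ : CarriesDirections A B A' B' χ a b) : CarriesDirections A B A'' B'' (ψ ∘ χ) a c := by
  obtain ⟨hχs, rfl, hχ⟩ := hχ
  obtain ⟨hψs, rfl, hψ⟩ := hψ
  refine ⟨hψs.comp a hχs, rfl, ?_⟩
  filter_upwards [hχ, hχs.eventually_differentiableAt, hχs.continuousAt.eventually hψ,
    hχs.continuousAt.eventually hψs.eventually_differentiableAt] with z hz hd hz' hd'
  obtain ⟨l, m, hl, hm, h1, h2⟩ := hz
  obtain ⟨l', m', hl', hm', h1', h2'⟩ := hz'
  refine ⟨l * l', m * m', mul_ne_zero hl hl', mul_ne_zero hm hm', ?_, ?_⟩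
  · rw [fderiv_comp z hd' hd, ContinuousLinearMap.comp_apply, h1, map_smul, h1', smul_smul]
    rfl
  · rw [fderiv_comp z hd' hd, ContinuousLinearMap.comp_apply, h2, map_smul, h2', smul_smul]
    rfl

theorem symm {e : OpenPartialHomeomorph R3 R3} (ha : a ∈ e.source)
    (h : CarriesDirections A B A' B' e a b) (hs : ContDiffAt ℝ ∞ e.symm b) :
    CarriesDirections A' B' A B e.symm b a := by
  obtain ⟨he, rfl, h⟩ := h
  have hinv : e.symm (e a) = a := e.left_inv ha
  refine ⟨hs, hinv, ?_⟩
  have hc : Tendsto e.symm (𝓝 (e a)) (𝓝 a) := by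
    simpa only [ContinuousAt, hinv] using hs.continuousAt
  filter_upwards [hc.eventually h, hs.eventually_differentiableAt,
    hc.eventually he.eventually_differentiableAt, e.open_target.mem_nhds (e.map_source ha)]
    with z hz hd hd' ht
  have hr : e (e.symm z) = z := e.right_inv ht
  have hcomp (v : R3) : fderiv ℝ e.symm z (fderiv ℝ e (e.symm z) v) = v := by
    have h1 : HasFDerivAt (e.symm ∘ e) ((fderiv ℝ e.symm z).comp (fderiv ℝ e (e.symm z)))
        (e.symm z) :=
      HasFDerivAt.comp _ (by rw [hr]; exact hd.hasFDerivAt) hd'.hasFDerivAt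
    have h2 : HasFDerivAt (e.symm ∘ e) (ContinuousLinearMap.id ℝ R3) (e.symm z) := by
      refine (hasFDerivAt_id _).congr_of_eventuallyEq ?_
      filter_upwards [e.open_source.mem_nhds (e.map_target ht)] with w hw
      exact e.left_inv hw
    exact congrArg (fun T : R3 →L[ℝ] R3 => T v) (h1.unique h2)
  obtain ⟨l, m, hl, hm, h1, h2⟩ := hz
  rw [hr] at h1 h2
  refine ⟨l⁻¹, m⁻¹, inv_ne_zero hl, inv_ne_zero hm, ?_, ?_⟩
  · rw [← hcomp (A (e.symm z)), h1, map_smul, smul_smul, inv_mul_cancel₀ hl, one_smul]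
  · rw [← hcomp (B (e.symm z)), h2, map_smul, smul_smul, inv_mul_cancel₀ hm, one_smul]

end CarriesDirections

/-- `solutionDir` spans the common kernel of `ω¹, ω²`, and `fibreDir` that of `ω¹, ω³`. The pullback
conditions preserve both kernels, with multipliers `b'` and `b`. -/
theorem PointEquivalentAt.exists_carriesDirections {E E' : SecondOrderODE} {z z' : R3}
    (h : E.PointEquivalentAt z E' z') : z ∈ E.dom ∧ z' ∈ E'.dom ∧
      (∃ χ, CarriesDirections E.solutionDir fibreDir E'.solutionDir fibreDir χ z z') ∧
      ∃ χ, CarriesDirections E'.solutionDir fibreDir E.solutionDir fibreDir χ z' z := by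
  obtain ⟨φ, hz, rfl, hs, ht, hφ, hφ', h⟩ := h
  have hC : CarriesDirections E.solutionDir fibreDir E'.solutionDir fibreDir φ z (φ z) := by
    refine ⟨hφ.contDiffAt (φ.open_source.mem_nhds hz), rfl, ?_⟩
    filter_upwards [φ.open_source.mem_nhds hz] with s hs
    obtain ⟨a, b, b', c, c', ha, hb, hb', h1, h2, h3⟩ := h s hs
    refine ⟨b', b, hb', hb, ?_, ?_⟩
    · have e1 := congrArg (fun T : R3 →L[ℝ] ℝ => T (E.solutionDir s)) h1
      have e2 := congrArg (fun T : R3 →L[ℝ] ℝ => T (E.solutionDir s)) h2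
      have e3 := congrArg (fun T : R3 →L[ℝ] ℝ => T (E.solutionDir s)) h3
      simp [omega1, omega2, omega3, dx, dy, dp, solutionDir] at e1 e2 e3
      simp only [solutionDir]
      ext
      · simpa using e3
      · simp only [Prod.smul_fst, Prod.smul_snd, smul_eq_mul]
        linear_combination e1 + (φ s).2.2 * e3
      · simp only [Prod.smul_snd, smul_eq_mul]
        linear_combination e2 + E'.Q (φ s) * e3
    · have e1 := congrArg (fun T : R3 →L[ℝ] ℝ => T (fibreDir s)) h1
      have e2 := congrArg (fun T : R3 →L[ℝ] ℝ => T (fibreDir s)) h2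
      have e3 := congrArg (fun T : R3 →L[ℝ] ℝ => T (fibreDir s)) h3
      simp [omega1, omega2, omega3, dx, dy, dp, fibreDir] at e1 e2 e3
      simp only [fibreDir]
      ext
      · simpa using e3
      · simp only [Prod.smul_fst, Prod.smul_snd, smul_eq_mul]
        linear_combination e1 + (φ s).2.2 * e3
      · simp only [Prod.smul_snd, smul_eq_mul]
        linear_combination e2 + E'.Q (φ s) * e3
  have hz' := φ.map_source hz
  exact ⟨hs hz, ht hz', ⟨_, hC⟩, _, hC.symm hz (hφ'.contDiffAt (φ.open_target.mem_nhds hz'))⟩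

/-! ### Duality as an exchange of solutions and fibres -/

theorem DualAt.symm {E F : SecondOrderODE} {z z' : R3} (h : E.DualAt z F z') :
    F.DualAt z' E z := by
  obtain ⟨u, W, v, W', hu, hv, huv, x, y, X, Y, hn, hz, hz'⟩ := h
  refine ⟨v, W', u, W, hv, hu, fun n => ?_, X, Y, x, y, ?_, hz', hz⟩
  · simpa using (huv n.swap).symm
  · exact (huv _).1 hn

theorem fderiv_apply_eq (f : R3 → ℝ) (z : R3) (v : R3) :
    fderiv ℝ f z v = v.1 * pd1 f z + v.2.1 * pd2 f z + v.2.2 * pd3 f z := by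
  have : v = v.1 • ((1, 0, 0) : R3) + v.2.1 • ((0, 1, 0) : R3) + v.2.2 • ((0, 0, 1) : R3) := by
    simp
  conv_lhs => rw [this]
  simp only [map_add, map_smul, smul_eq_mul, pd1, pd2, pd3]

/-- The first jet of the solution `x ↦ u (x, X, Y)`. -/
noncomputable def jet (u : R3 → ℝ) (t : R3) : R3 := (t.1, u t, pd1 u t)

/-- The direction in the space of `(x, X, Y)` along which `x` and `u` are constant. -/
noncomputable def levelDir (u : R3 → ℝ) (t : R3) : R3 := (0, pd3 u t, -pd2 u t)

theorem contDiffAt_pd1 {f : R3 → ℝ} {z : R3} (hf : ContDiffAt ℝ ∞ f z) : ContDiffAt ℝ ∞ (pd1 f) z :=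
  hf.fderiv_apply_const dirX

theorem contDiffAt_jet {u : R3 → ℝ} {t : R3} (hu : ContDiffAt ℝ ∞ u t) :
    ContDiffAt ℝ ∞ (jet u) t :=
  contDiff_fst.contDiffAt.prodMk (hu.prodMk (contDiffAt_pd1 hu))

theorem fderiv_jet {u : R3 → ℝ} {t : R3} (hu : ContDiffAt ℝ ∞ u t) (v : R3) :
    fderiv ℝ (jet u) t v = (v.1, fderiv ℝ u t v, fderiv ℝ (pd1 u) t v) := by
  have h1 := (hu.differentiableAt (by simp)).hasFDerivAt
  have h2 := ((contDiffAt_pd1 hu).differentiableAt (by simp)).hasFDerivAt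
  have h3 : HasFDerivAt (jet u) _ t := hasFDerivAt_fst.prodMk (h1.prodMk h2)
  rw [h3.fderiv]
  rfl

theorem IsGeneralSolution.contDiffAt {E : SecondOrderODE} {u : R3 → ℝ} {W : Set R3}
    (h : E.IsGeneralSolution u W) {t : R3} (ht : t ∈ W) : ContDiffAt ℝ ∞ u t :=
  h.2.1.contDiffAt (h.1.mem_nhds ht)

/-- Varying `x` with the constants fixed moves the jet along a solution; varying the constants with
`x` and `u` fixed changes only the slope, at a rate that is the Jacobian up to sign. -/
theorem IsGeneralSolution.carriesDirections_jet {E : SecondOrderODE} {u : R3 → ℝ} {W : Set R3}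
    (h : E.IsGeneralSolution u W) {t : R3} (ht : t ∈ W) :
    CarriesDirections (fun _ => dirX) (levelDir u) E.solutionDir fibreDir (jet u) t (jet u t) := by
  refine ⟨contDiffAt_jet (h.contDiffAt ht), rfl, ?_⟩
  filter_upwards [h.1.mem_nhds ht] with s hs
  obtain ⟨-, h1, h2⟩ := h.2.2 s hs
  refine ⟨1, pd3 u s * pd2 (pd1 u) s - pd2 u s * pd3 (pd1 u) s, one_ne_zero, ?_, ?_, ?_⟩
  · intro h0
    exact h2 (by linarith)
  · rw [fderiv_jet (h.contDiffAt hs), one_smul]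
    simp only [fderiv_apply_eq, h1, solutionDir, jet]
    simp
  · rw [fderiv_jet (h.contDiffAt hs)]
    simp only [fderiv_apply_eq, levelDir, fibreDir]
    ext <;> simp <;> ring

/-- The nonvanishing Jacobian makes `jet u` a local diffeomorphism, by the inverse function theorem.
-/
theorem IsGeneralSolution.exists_carriesDirections_inverse {E : SecondOrderODE} {u : R3 → ℝ}
    {W : Set R3} (h : E.IsGeneralSolution u W) {t : R3} (ht : t ∈ W) :
    ∃ χ, CarriesDirections E.solutionDir fibreDir (fun _ => dirX) (levelDir u) χ (jet u t) t := by
  have hu := h.contDiffAt ht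
  have hj := contDiffAt_jet hu
  obtain ⟨-, -, h2⟩ := h.2.2 t ht
  have hinj : Function.Injective (fderiv ℝ (jet u) t : R3 →ₗ[ℝ] R3) := by
    rw [injective_iff_map_eq_zero]
    rintro ⟨x, y, p⟩ hv
    replace hv : fderiv ℝ (jet u) t (x, y, p) = 0 := hv
    rw [fderiv_jet hu] at hv
    simp only [fderiv_apply_eq, Prod.mk_eq_zero] at hv
    obtain ⟨rfl, e1, e2⟩ := hv
    simp only [Prod.mk_eq_zero, true_and]
    constructor
    · apply (mul_eq_zero.1 _).resolve_right h2
      linear_combination pd3 (pd1 u) t * e1 - pd3 u t * e2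
    · apply (mul_eq_zero.1 _).resolve_right h2
      linear_combination pd2 u t * e2 - pd2 (pd1 u) t * e1
  let T : R3 ≃L[ℝ] R3 := (LinearEquiv.ofInjectiveEndo _ hinj).toContinuousLinearEquiv
  have hT : HasFDerivAt (jet u) (T : R3 →L[ℝ] R3) t := by
    have : (T : R3 →L[ℝ] R3) = fderiv ℝ (jet u) t := ContinuousLinearMap.ext fun _ => rfl
    rw [this]
    exact (hj.differentiableAt (by simp)).hasFDerivAt
  have hn : (∞ : WithTop ℕ∞) ≠ 0 := by simp
  exact ⟨_, CarriesDirections.symm (e := hj.toOpenPartialHomeomorph (jet u) hT hn)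
    (hj.mem_toOpenPartialHomeomorph_source hT hn) (h.carriesDirections_jet ht)
    (hj.to_localInverse hT hn)⟩

/-- On the hypersurface with coordinates `(x, X, Y)` the roles are reversed: `∂_x` fixes `(X, Y)`,
so it moves the dual jet along a fibre, while `levelDir u` fixes the constants `(x, y)` of `F`, so
it moves the dual jet along a solution. -/
theorem carriesDirections_dualJet {F : SecondOrderODE} {u v : R3 → ℝ} {W W' : Set R3}
    (hW : IsOpen W) (hu : ContDiffOn ℝ ∞ u W) (hv : F.IsGeneralSolution v W')
    (huv : ∀ t ∈ W, (t.2.1, t.1, u t) ∈ W' ∧ v (t.2.1, t.1, u t) = t.2.2) {t : R3} (ht : t ∈ W) :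
    CarriesDirections (fun _ => dirX) (levelDir u) fibreDir F.solutionDir
      (fun t => jet v (t.2.1, t.1, u t)) t (jet v (t.2.1, t.1, u t)) := by
  obtain ⟨g, hg⟩ : ∃ g : R3 → R3, g = fun t => (t.2.1, t.1, u t) := ⟨_, rfl⟩
  have hus (s) (hs : s ∈ W) : ContDiffAt ℝ ∞ u s := hu.contDiffAt (hW.mem_nhds hs)
  have hgs (s) (hs : s ∈ W) : ContDiffAt ℝ ∞ g s := by
    rw [hg]
    exact contDiff_snd.fst.contDiffAt.prodMk (contDiff_fst.contDiffAt.prodMk (hus s hs))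
  have hvs (s) (hs : s ∈ W) : ContDiffAt ℝ ∞ v (g s) := by
    rw [hg]
    exact hv.contDiffAt (huv s hs).1
  have hdg (s) (hs : s ∈ W) (w : R3) : fderiv ℝ g s w = (w.2.1, w.1, fderiv ℝ u s w) := by
    have h1 := (hasFDerivAt_snd (𝕜 := ℝ) (p := s)).fst.prodMk
      ((hasFDerivAt_fst (𝕜 := ℝ) (p := s)).prodMk
        ((hus s hs).differentiableAt (by simp)).hasFDerivAt)
    rw [hg]
    exact congrArg (fun T : R3 →L[ℝ] R3 => T w) h1.fderiv
  have hvg (s) (hs : s ∈ W) (w : R3) : fderiv ℝ v (g s) (fderiv ℝ g s w) = w.2.2 := by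
    have h1 : HasFDerivAt (v ∘ g) ((fderiv ℝ v (g s)).comp (fderiv ℝ g s)) s :=
      HasFDerivAt.comp _ ((hvs s hs).differentiableAt (by simp)).hasFDerivAt
        ((hgs s hs).differentiableAt (by simp)).hasFDerivAt
    have h2 : HasFDerivAt (v ∘ g) ((ContinuousLinearMap.snd ℝ ℝ ℝ).comp
        (ContinuousLinearMap.snd ℝ ℝ (ℝ × ℝ))) s := by
      refine ((ContinuousLinearMap.snd ℝ ℝ ℝ).comp
        (ContinuousLinearMap.snd ℝ ℝ (ℝ × ℝ))).hasFDerivAt.congr_of_eventuallyEq ?_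
      filter_upwards [hW.mem_nhds hs] with w hw
      rw [hg]
      exact (huv w hw).2
    exact congrArg (fun T : R3 →L[ℝ] ℝ => T w) (h1.unique h2)
  have hcongr : (fun t : R3 => jet v (t.2.1, t.1, u t)) = jet v ∘ g := by rw [hg]; rfl
  rw [hcongr]
  refine ⟨(contDiffAt_jet (hvs t ht)).comp t (hgs t ht), by rw [hg]; rfl, ?_⟩
  filter_upwards [hW.mem_nhds ht] with s hs
  have hd (w : R3) : fderiv ℝ (jet v ∘ g) s w =
      (w.2.1, w.2.2, fderiv ℝ (pd1 v) (g s) (w.2.1, w.1, fderiv ℝ u s w)) := by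
    rw [fderiv_comp s ((contDiffAt_jet (hvs s hs)).differentiableAt (by simp))
      ((hgs s hs).differentiableAt (by simp)), ContinuousLinearMap.comp_apply,
      fderiv_jet (hvs s hs), hvg s hs, hdg s hs]
  obtain ⟨-, q1, q2⟩ := hv.2.2 _ (huv s hs).1
  rw [show ((s.2.1, s.1, u s) : R3) = g s by rw [hg]] at q1 q2
  -- Implicit differentiation of `v (X, x, u (x, X, Y)) = Y` in `x`, `X` and `Y`.
  have ex := hvg s hs (1, 0, 0)
  have eX := hvg s hs (0, 1, 0)
  have eY := hvg s hs (0, 0, 1)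
  rw [hdg s hs] at ex eX eY
  simp only [fderiv_apply_eq, zero_mul, one_mul, zero_add, add_zero] at ex eX eY
  refine ⟨pd2 (pd1 v) (g s) + pd1 u s * pd3 (pd1 v) (g s), pd3 u s, ?_, ?_, ?_, ?_⟩
  -- If this multiplier vanished, then by `ex` the vector `(1, u_x)` would lie in the kernel of the
  -- Jacobian matrix of `v`.
  · intro h0
    apply q2
    linear_combination pd3 (pd1 v) (g s) * ex - pd3 v (g s) * h0
  · intro h0
    rw [h0, zero_mul] at eY
    exact zero_ne_one eY
  · rw [hd]
    simp [fderiv_apply_eq, fibreDir]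
  · have hX : pd3 u s * pd1 v (g s) = -pd2 u s := by
      linear_combination pd3 u s * eX - pd2 u s * eY
    rw [hd]
    simp only [fderiv_apply_eq, levelDir, solutionDir, jet, Function.comp_apply, q1]
    ext
    · simp
    · simpa using hX.symm
    · simp
      left
      ring

/-- The map lifts a jet of `E` to the hypersurface by the local inverse of `jet u`, then takes the
jet of `v` there. -/
theorem DualAt.exists_carriesDirections {E F : SecondOrderODE} {z z' : R3}
    (h : E.DualAt z F z') :
    ∃ χ, CarriesDirections E.solutionDir fibreDir fibreDir F.solutionDir χ z z' := by
  obtain ⟨u, W, v, W', hu, hv, huv, x, y, X, Y, ⟨hn, hy⟩, rfl, rfl⟩ := h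
  have hW (t : R3) (ht : t ∈ W) : (t.2.1, t.1, u t) ∈ W' ∧ v (t.2.1, t.1, u t) = t.2.2 := by
    have := (huv ((t.1, u t), (t.2.1, t.2.2))).1 ⟨ht, rfl⟩
    exact ⟨this.1, this.2.symm⟩
  dsimp only at hn hy
  obtain ⟨χ, hχ⟩ := hu.exists_carriesDirections_inverse hn
  have hψ := carriesDirections_dualJet hu.1 hu.2.1 hv hW hn
  have e1 : (x, y, pd1 u (x, X, Y)) = jet u (x, X, Y) := by rw [jet, hy]
  have e2 : (X, Y, pd1 v (X, x, y)) = jet v (X, x, u (x, X, Y)) := by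
    rw [jet, (hW _ hn).2, hy]
  rw [e1, e2]
  exact ⟨_, hψ.comp hχ⟩

/-! ### Interchange of the relative invariants -/

theorem w1_eq_zero_iff_of_carriesDirections {E F : SecondOrderODE} {a b : R3} (ha : a ∈ E.dom)
    (hb : b ∈ F.dom)
    (h : ∃ χ, CarriesDirections E.solutionDir fibreDir fibreDir F.solutionDir χ a b) :
    E.w1 a = 0 ↔ F.w2 b = 0 := by
  obtain ⟨χ, hχ, rfl, h⟩ := h
  obtain ⟨c, hc, hcw⟩ := w1_eq_of_exchange (E.contDiffAt_Q ha) (F.contDiffAt_Q hb) hχ h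
  rw [hcw, mul_eq_zero, or_iff_right hc]

/-- The exchange identity relates only `w₁` of the source to `w₂` of the target. The other
equivalence comes from the reversed chain `b₀ → b → a → a₀`, as duality is symmetric. -/
theorem relative_invariants_interchange {E₀ E F F₀ : SecondOrderODE} {a₀ a b b₀ : R3}
    (hE : E₀.PointEquivalentAt a₀ E a) (hEF : E.DualAt a F b) (hF : F.PointEquivalentAt b F₀ b₀) :
    (F₀.w1 b₀ = 0 ↔ E₀.w2 a₀ = 0) ∧ (F₀.w2 b₀ = 0 ↔ E₀.w1 a₀ = 0) := by
  obtain ⟨ha₀, -, ⟨φ, hφ⟩, φ', hφ'⟩ := hE.exists_carriesDirections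
  obtain ⟨-, hb₀, ⟨ψ, hψ⟩, ψ', hψ'⟩ := hF.exists_carriesDirections
  obtain ⟨χ, hχ⟩ := hEF.exists_carriesDirections
  obtain ⟨χ', hχ'⟩ := hEF.symm.exists_carriesDirections
  have swap {A B A' B' g : R3 → R3} {a b : R3} (h : CarriesDirections A B A' B' g a b) :
      CarriesDirections B A B' A' g a b := by
    refine ⟨h.1, h.2.1, h.2.2.mono fun z hz => ?_⟩
    obtain ⟨l, m, hl, hm, h1, h2⟩ := hz
    exact ⟨m, l, hm, hl, h2, h1⟩
  exact ⟨w1_eq_zero_iff_of_carriesDirections hb₀ ha₀ ⟨_, (swap hφ').comp (hχ'.comp hψ')⟩,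
    (w1_eq_zero_iff_of_carriesDirections ha₀ hb₀ ⟨_, (swap hψ).comp (hχ.comp hφ)⟩).symm⟩

end SecondOrderODE

theorem proposition2 :
    -- the dual class of a class with `w₂ = 0` and `w₁ ≠ 0` has `w₂ ≠ 0` and `w₁ = 0`, where `≠ 0`
    -- may be read as 'nowhere zero' or as 'not identically zero'
    (∀ E : SecondOrderODE, (∀ z ∈ E.dom, E.w2 z = 0) →
      ∀ F ∈ SecondOrderODE.dualClass E.pointClass,
        (∀ z ∈ F.dom, F.w1 z = 0) ∧
        ((∀ z ∈ E.dom, E.w1 z ≠ 0) → ∀ z ∈ F.dom, F.w2 z ≠ 0) ∧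
        ((∃ z ∈ E.dom, E.w1 z ≠ 0) → ∃ z ∈ F.dom, F.w2 z ≠ 0)) ∧
    -- duality interchanges the two relative invariants, at corresponding points of any members
    -- `E₀`, `F₀` of the two classes
    (∀ (E₀ E F F₀ : SecondOrderODE) (a₀ a b b₀ : R3),
      E₀.PointEquivalentAt a₀ E a → E.DualAt a F b → F.PointEquivalentAt b F₀ b₀ →
        (F₀.w1 b₀ = 0 ↔ E₀.w2 a₀ = 0) ∧ (F₀.w2 b₀ = 0 ↔ E₀.w1 a₀ = 0)) := by

  refine ⟨?_, fun E₀ E F F₀ a₀ a b b₀ hE hEF hF =>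
    SecondOrderODE.relative_invariants_interchange hE hEF hF⟩
  rintro E hw2 F ⟨E', hE', F', hdual, hF⟩
  -- The pointwise statements about `F` need every point of `F.dom` traced back to `E.dom`; "not
  -- identically zero" instead needs one point of `E.dom` carried forward.
  have back (z) (hz : z ∈ F.dom) :
      ∃ a₀ ∈ E.dom, (F.w1 z = 0 ↔ E.w2 a₀ = 0) ∧ (F.w2 z = 0 ↔ E.w1 a₀ = 0) := by
    obtain ⟨b, hb, hb'⟩ := hF.2 z hz
    obtain ⟨a, ha, ha'⟩ := hdual.2 b hb
    obtain ⟨a₀, ha₀, ha₀'⟩ := hE'.2 a ha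
    exact ⟨a₀, ha₀, SecondOrderODE.relative_invariants_interchange ha₀' ha' hb'⟩
  refine ⟨fun z hz => ?_, fun h z hz => ?_, ?_⟩
  · obtain ⟨a₀, ha₀, h1, -⟩ := back z hz
    exact h1.2 (hw2 a₀ ha₀)
  · obtain ⟨a₀, ha₀, -, h2⟩ := back z hz
    exact fun h0 => h a₀ ha₀ (h2.1 h0)
  · rintro ⟨a₀, ha₀, h⟩
    obtain ⟨a, ha, ha'⟩ := hE'.1 a₀ ha₀
    obtain ⟨b, hb, hb'⟩ := hdual.1 a ha
    obtain ⟨z, hz, hz'⟩ := hF.1 b hb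
    exact ⟨z, hz, fun h0 =>
      h ((SecondOrderODE.relative_invariants_interchange ha' hb' hz').2.1 h0)⟩
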